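/- Let $G$ be a three-dimensional Lie group with a bi-invariant Riemannian metric and Lie algebra $\mathfrak g$. Using left translations and an orthonormal basis $X_1,X_2,X_3$ of $\mathfrak g$, identify vector fields $W=\sum w_iX_i$ along a curve with curves in $\mathfrak g\cong\mathbb R^3$ (oriented by the basis), and write $W'=\sum w_i'X_i$. Let $\alpha:J\to G$ ($J$ an open interval) be a smooth arc-length parametrized curve with Frenet apparatus $(T,N,B,\kappa,\tau)$, $\kappa>0$: thus $T=\alpha'$, $(T,N,B)$ is a positively oriented orthonormal frame, and $D_TT=\kappa N$, $D_TN=-\kappa T+\tau B$, $D_TB=-\tau N$, where $D_TW=W'+\frac12[T,W]$. Put $\tau_G=\frac12\langle[T,N],B\rangle$. Assume that $\alpha$ is a Bertrand curve: there are a smooth arc-length parametrized curve $\tilde\alpha$ with Frenet apparatus $(\tilde T,\tilde N,\tilde B,\tilde\kappa,\tilde\tau)$, $\tilde\kappa>0$, on an open interval $\tilde J$, a smooth bijection $s\mapsto s^*$ from $J$ onto $\tilde J$ with nonvanishing derivative, a sign $\epsilon=\pm1$ and a constant $\lambda\neq0$ with $N(s)=\epsilon\tilde N(s^*)$ and $\tilde\alpha(s^*)=\alpha(s)+\lambda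 N(s)$, the last equation meaning $\frac{ds^*}{ds}\tilde T(s^*)=T(s)+\lambda N'(s)$. Assume also that $\tau-\tau_G$ has no zero on $J$, so that the binormal indicatrix is regular. Consider the tangent indicatrix $\alpha_t=T$ and the binormal indicatrix $\alpha_b=B$, which are curves on the unit sphere $S^2\subset\mathfrak g$. For $c\in\{t,b\}$ and a natural parameter $s_c$ of $\alpha_c$ (so $|ds_c/ds|=\|\alpha_c'\|$), put $T_c=d\alpha_c/ds_c$, $N_c=T_c'/\|T_c'\|$, $B_c=T_c\times N_c$, where $'$ is the derivative with respect to $s$; in $dT_c/ds_c=\kappa_cN_c$ the curvature $\kappa_c$ then has the sign of $ds_c/ds$. Let $\Gamma_c$ be the geodesic curvature of the spherical curve $s\mapsto N_c(s)\in S^2$ (the principal normal image of $\alpha_c$). (1) With the natural parameters given by $\frac{ds_t}{ds}=\kappa$ and $\frac{ds_b}{ds}=-(\tau-\tau_G)$, the curves $N_t$ and $N_b$ on $S^2$ are regular with nonzero curvature, and $$\Gamma_t=\Gamma_b .$$ The spherical images of $\alpha_t$ and $\alpha_b$ have, at corresponding parameters, the same curvature and the same torsion as curves in $\mathfrak g\cong\mathbb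 R^3$: this holds for the principal normal images $N_t$ and $N_b$, for the tangent images $T_t$ and $T_b$, and for the binormal images $B_t$ and $B_b$ (the latter wherever they are regular). (2) If instead both natural parameters increase with $s$ (so that $\kappa_t,\kappa_b>0$), put $\sigma=-\operatorname{sgn}(\tau-\tau_G)$. Then $\Gamma_b=\sigma\Gamma_t$. The curves $N_b$ and $N_t$ have the same curvature, and the torsion of $N_b$ is $\sigma$ times that of $N_t$; the same holds for $T_b$ and $T_t$. The curves $B_b$ and $B_t$ have the same curvature and the same torsion (wherever they are regular). -/

import Mathlib

open scoped Manifold ContDiff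

noncomputable section

namespace LieBertrand

/-- Euclidean three-space with its standard orientation. A vector of the Lie algebra is
represented by its coordinates in an orthonormal basis, so the unit sphere of the Lie algebra is
the unit sphere of this space. -/
abbrev E3 : Type := EuclideanSpace ℝ (Fin 3)

/-- The cross product of oriented Euclidean three-space. -/
def cross (a b : E3) : E3 := WithLp.toLp 2 (crossProduct (WithLp.ofLp a) (WithLp.ofLp b))

section CurvesInSpace

/-- Curvature of a regular parametrized curve in Euclidean three-space:
`‖c' × c''‖ / ‖c'‖ ^ 3`. -/
def curvature (c : ℝ → E3) (s : ℝ) : ℝ :=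
  ‖cross (deriv c s) (deriv (deriv c) s)‖ / ‖deriv c s‖ ^ 3

/-- Torsion of a regular parametrized curve with nonzero curvature in Euclidean three-space:
`⟨c' × c'', c'''⟩ / ‖c' × c''‖ ^ 2`. -/
def torsion (c : ℝ → E3) (s : ℝ) : ℝ :=
  inner ℝ (cross (deriv c s) (deriv (deriv c) s)) (deriv (deriv (deriv c)) s) /
    ‖cross (deriv c s) (deriv (deriv c) s)‖ ^ 2

/-- Geodesic curvature of a regular parametrized curve lying on the unit sphere:
`⟨c'', c × c'⟩ / ‖c'‖ ^ 3`. -/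
def geodesicCurvature (c : ℝ → E3) (s : ℝ) : ℝ :=
  inner ℝ (deriv (deriv c) s) (cross (c s) (deriv c s)) / ‖deriv c s‖ ^ 3

/-- The unit tangent of the curve `c`, for a natural parameter `s_c` of `c` with
`d s_c / d s = v` (so `|v| = ‖c'‖`; `s_c` may run in either direction): this is
`d c / d s_c`. -/
def unitTangent (c : ℝ → E3) (v : ℝ → ℝ) (s : ℝ) : E3 := (v s)⁻¹ • deriv c s

/-- The principal normal of the curve `c`: the direction in which its unit tangent turns as the
parameter `s` increases. With this choice the curvature in
`d T_c / d s_c = κ_c N_c` has the sign of `v`; it is positive when `v = ‖c'‖`. -/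
def principalNormal (c : ℝ → E3) (v : ℝ → ℝ) (s : ℝ) : E3 :=
  ‖deriv (unitTangent c v) s‖⁻¹ • deriv (unitTangent c v) s

/-- The binormal of the curve `c`. -/
def binormal (c : ℝ → E3) (v : ℝ → ℝ) (s : ℝ) : E3 :=
  cross (unitTangent c v s) (principalNormal c v s)

/-- The two curves have the same curvature at `s`, and the torsion of `d` is `σ` times the torsion
of `c`. -/
def SameShape (σ : ℝ) (c d : ℝ → E3) (s : ℝ) : Prop :=
  curvature d s = curvature c s ∧ torsion d s = σ * torsion c s

/-- At `s` the curve `c` on the unit sphere is regular and has nonzero curvature. -/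
def IsRegularSpherical (c : ℝ → E3) (s : ℝ) : Prop :=
  ‖c s‖ = 1 ∧ deriv c s ≠ 0 ∧ 0 < curvature c s

end CurvesInSpace

section CurvesInGroup

variable {E : Type*} [NormedAddCommGroup E] [NormedSpace ℝ E]
  {G : Type*} [TopologicalSpace G] [ChartedSpace E G] [Group G]

/-- A Riemannian metric on a Lie group is bi-invariant if all left and all right translations are
isometries. -/
def IsBiInvariant [IsManifold 𝓘(ℝ, E) 1 G]
    (g : Bundle.ContMDiffRiemannianMetric 𝓘(ℝ, E) ∞ E
      (fun x : G => TangentSpace 𝓘(ℝ, E) x)) : Prop :=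
  (∀ (h x : G) (u w : TangentSpace 𝓘(ℝ, E) x),
    g.inner (h * x) (mfderiv 𝓘(ℝ, E) 𝓘(ℝ, E) (fun y : G => h * y) x u)
      (mfderiv 𝓘(ℝ, E) 𝓘(ℝ, E) (fun y : G => h * y) x w) = g.inner x u w) ∧
  (∀ (h x : G) (u w : TangentSpace 𝓘(ℝ, E) x),
    g.inner (x * h) (mfderiv 𝓘(ℝ, E) 𝓘(ℝ, E) (fun y : G => y * h) x u)
      (mfderiv 𝓘(ℝ, E) 𝓘(ℝ, E) (fun y : G => y * h) x w) = g.inner x u w)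

/-- The basis `X` of the Lie algebra is orthonormal. -/
def IsOrthonormalBasis [IsManifold 𝓘(ℝ, E) 1 G]
    (g : Bundle.ContMDiffRiemannianMetric 𝓘(ℝ, E) ∞ E
      (fun x : G => TangentSpace 𝓘(ℝ, E) x))
    (X : Module.Basis (Fin 3) ℝ (GroupLieAlgebra 𝓘(ℝ, E) G)) : Prop :=
  ∀ i j, g.inner 1 (X i) (X j) = if i = j then 1 else 0

/-- The element `∑ aᵢ Xᵢ` of the Lie algebra. -/
def toAlg (X : Module.Basis (Fin 3) ℝ (GroupLieAlgebra 𝓘(ℝ, E) G)) (a : E3) :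
    GroupLieAlgebra 𝓘(ℝ, E) G := ∑ i, a i • X i

/-- The Lie bracket of the Lie algebra in the coordinates given by `X`. -/
def bracket (X : Module.Basis (Fin 3) ℝ (GroupLieAlgebra 𝓘(ℝ, E) G)) (a b : E3) : E3 :=
  WithLp.toLp 2 (fun i => X.repr ⁅toAlg X a, toAlg X b⁆ i)

/-- The covariant derivative `D_T W = W' + (1/2) [T, W]` of the Levi-Civita connection of a
bi-invariant metric, for a vector field `W = ∑ wᵢ Xᵢ` along a curve with velocity
`T = ∑ tᵢ Xᵢ`, where the `Xᵢ` are left-invariant and `W' = ∑ wᵢ' Xᵢ`. -/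
def covDeriv (X : Module.Basis (Fin 3) ℝ (GroupLieAlgebra 𝓘(ℝ, E) G)) (T W : ℝ → E3)
    (s : ℝ) : E3 :=
  deriv W s + (1 / 2 : ℝ) • bracket X (T s) (W s)

/-- The data `(T, N, B, κ, τ)`; the vector fields are given by their coordinates in a
left-invariant orthonormal frame. -/
structure Apparatus where
  T : ℝ → E3
  N : ℝ → E3
  B : ℝ → E3
  κ : ℝ → ℝ
  τ : ℝ → ℝ

/-- `τ_G = (1/2) ⟨[T, N], B⟩`. -/
def tauG (X : Module.Basis (Fin 3) ℝ (GroupLieAlgebra 𝓘(ℝ, E) G)) (A : Apparatus)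
    (s : ℝ) : ℝ :=
  (1 / 2 : ℝ) * inner ℝ (bracket X (A.T s) (A.N s)) (A.B s)

/-- The derivative `d s_t / d s = κ` of the natural parameter `s_t` of the tangent indicatrix. -/
def tangentRate (A : Apparatus) (s : ℝ) : ℝ := A.κ s

/-- The derivative `d s_b / d s = -(τ - τ_G)` of the natural parameter `s_b` of the binormal
indicatrix; with this parameter both indicatrices have the unit tangent `N`. -/
def binormalRate (X : Module.Basis (Fin 3) ℝ (GroupLieAlgebra 𝓘(ℝ, E) G)) (A : Apparatus)
    (s : ℝ) : ℝ := -(A.τ s - tauG X A s)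

/-- `α` is a smooth arc-length parametrized curve on the open interval `J` with nonvanishing
curvature, and `A` is its Frenet apparatus. -/
structure IsFrenetCurve (X : Module.Basis (Fin 3) ℝ (GroupLieAlgebra 𝓘(ℝ, E) G))
    (J : Set ℝ) (α : ℝ → G) (A : Apparatus) : Prop where
  isOpen : IsOpen J
  ordConnected : J.OrdConnected
  smooth : ContMDiffOn 𝓘(ℝ, ℝ) 𝓘(ℝ, E) ∞ α J
  smooth_T : ContDiffOn ℝ ∞ A.T J
  smooth_N : ContDiffOn ℝ ∞ A.N J
  smooth_B : ContDiffOn ℝ ∞ A.B J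
  /-- The velocity of `α` at `s` is the value at `α s` of the left-invariant vector field with
  coordinates `T s`. -/
  velocity : ∀ s ∈ J, mfderiv 𝓘(ℝ, ℝ) 𝓘(ℝ, E) α s (1 : ℝ) =
    mulInvariantVectorField (toAlg X (A.T s)) (α s)
  orthonormal : ∀ s ∈ J, Orthonormal ℝ ![A.T s, A.N s, A.B s]
  oriented : ∀ s ∈ J, A.B s = cross (A.T s) (A.N s)
  curvature_pos : ∀ s ∈ J, 0 < A.κ s
  frenet_T : ∀ s ∈ J, covDeriv X A.T A.T s = A.κ s • A.N s
  frenet_N : ∀ s ∈ J, covDeriv X A.T A.N s = -A.κ s • A.T s + A.τ s • A.B s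
  frenet_B : ∀ s ∈ J, covDeriv X A.T A.B s = -A.τ s • A.N s

/-- `(α, β)` is a Bertrand pair: under a smooth regular bijection `φ` of the parameter intervals
the principal normals agree up to sign, and `β ∘ φ = α + lam N` with a nonzero constant `lam`.
In the group the last equation is understood in the left trivialization: it says that the velocity
of `β ∘ φ` is `T + lam N'`, where `N' = ∑ nᵢ' Xᵢ` (`= D_T N - (1/2) [T, N]`). -/
def IsBertrandPair (X : Module.Basis (Fin 3) ℝ (GroupLieAlgebra 𝓘(ℝ, E) G))
    (J : Set ℝ) (α : ℝ → G) (A : Apparatus) (J' : Set ℝ) (β : ℝ → G) (A' : Apparatus) : Prop :=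
  IsFrenetCurve X J α A ∧ IsFrenetCurve X J' β A' ∧
  ∃ (φ : ℝ → ℝ) (ε lam : ℝ), (ε = 1 ∨ ε = -1) ∧ lam ≠ 0 ∧
    ContDiffOn ℝ ∞ φ J ∧ Set.BijOn φ J J' ∧
    ∀ s ∈ J, deriv φ s ≠ 0 ∧ A.N s = ε • A'.N (φ s) ∧
      deriv φ s • A'.T (φ s) = A.T s + lam • deriv A.N s

/-- `α` is a Bertrand curve with Frenet apparatus `A`: it has a Bertrand mate. -/
def IsBertrandCurve (X : Module.Basis (Fin 3) ℝ (GroupLieAlgebra 𝓘(ℝ, E) G))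
    (J : Set ℝ) (α : ℝ → G) (A : Apparatus) : Prop :=
  ∃ (J' : Set ℝ) (β : ℝ → G) (A' : Apparatus), IsBertrandPair X J α A J' β A'

end CurvesInGroup

end LieBertrand

end

open LieBertrand

open scoped Topology

namespace LieBertrand

/-! ### Cross product identities. -/

section CrossProduct

/-! Both indicatrices move along the principal normal: `T' = κ N` because `[T, T] = 0`, and `B' =
-(τ - τ_G) N` (`deriv_T`, `deriv_B`). Dividing by the signed rates gives both the unit tangent `N`.
The principal normal and binormal images are built from the unit tangent alone, so all the images
coincide. With increasing parameters the unit tangents are `N` and `σ N`, where the sign `σ` is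
locally constant. The invariants then change only as under multiplication by `σ`
(`indicatrices_of_sign_smul`). Regularity of the principal normal images, both equal to `N' / ‖N'‖`,
is a fact about spherical curves. -/

lemma cross_smul_smul {σ : ℝ} (hσ : σ * σ = 1) (a b : E3) : cross (σ • a) (σ • b) = cross a b := by
  simp [cross, smul_smul, hσ]

/-- The Binet–Cauchy identity. -/
lemma inner_cross_cross (a b c d : E3) :
    inner ℝ (cross a b) (cross c d) =
      inner ℝ a c * inner ℝ b d - inner ℝ a d * inner ℝ b c := by
  simp only [cross, cross_apply, PiLp.inner_apply, Fin.sum_univ_three, RCLike.inner_apply,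
    conj_trivial, Matrix.cons_val_zero, Matrix.cons_val_one, Matrix.cons_val]
  ring

end CrossProduct

/-! ### Invariants of curves under a constant sign. -/

section SignChange

variable {σ : ℝ} {c d : ℝ → E3} {s : ℝ}

lemma norm_sign_smul (hσ : σ * σ = 1) (a : E3) : ‖σ • a‖ = ‖a‖ := by
  rcases mul_self_eq_one_iff.mp hσ with rfl | rfl <;> simp

/-- The conclusion has the shape of the hypothesis, so the lemma can be iterated to reach higher
derivatives. -/
lemma eventuallyEq_deriv_of_sign_smul (h : d =ᶠ[𝓝 s] fun u => σ • c u) :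
    deriv d =ᶠ[𝓝 s] fun u => σ • deriv c u :=
  h.deriv.trans (Filter.Eventually.of_forall fun _ => deriv_fun_const_smul_field σ c)

lemma curvature_of_sign_smul (hσ : σ * σ = 1) (h : d =ᶠ[𝓝 s] fun u => σ • c u) :
    curvature d s = curvature c s := by
  have h1 := eventuallyEq_deriv_of_sign_smul h
  have h2 := eventuallyEq_deriv_of_sign_smul h1
  simp only [curvature, h1.eq_of_nhds, h2.eq_of_nhds, cross_smul_smul hσ, norm_sign_smul hσ]

/-- The point reflection reverses orientation: `c' × c''` is unchanged, and `c'''` contributes one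
factor `σ`. -/
lemma torsion_of_sign_smul (hσ : σ * σ = 1) (h : d =ᶠ[𝓝 s] fun u => σ • c u) :
    torsion d s = σ * torsion c s := by
  have h1 := eventuallyEq_deriv_of_sign_smul h
  have h2 := eventuallyEq_deriv_of_sign_smul h1
  have h3 := eventuallyEq_deriv_of_sign_smul h2
  simp only [torsion, h1.eq_of_nhds, h2.eq_of_nhds, h3.eq_of_nhds, cross_smul_smul hσ,
    inner_smul_right]
  ring

lemma sameShape_of_sign_smul (hσ : σ * σ = 1) (h : d =ᶠ[𝓝 s] fun u => σ • c u) :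
    SameShape σ c d s :=
  ⟨curvature_of_sign_smul hσ h, torsion_of_sign_smul hσ h⟩

lemma sameShape_one_of_eventuallyEq (h : d =ᶠ[𝓝 s] c) : SameShape 1 c d s :=
  sameShape_of_sign_smul (one_mul 1) (h.trans (by simp))

lemma geodesicCurvature_of_sign_smul (hσ : σ * σ = 1) (h : d =ᶠ[𝓝 s] fun u => σ • c u) :
    geodesicCurvature d s = σ * geodesicCurvature c s := by
  have h1 := eventuallyEq_deriv_of_sign_smul h
  have h2 := eventuallyEq_deriv_of_sign_smul h1
  simp only [geodesicCurvature, h.eq_of_nhds, h1.eq_of_nhds, h2.eq_of_nhds, cross_smul_smul hσ,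
    norm_sign_smul hσ, real_inner_smul_left]
  ring

lemma IsRegularSpherical.congr (hc : IsRegularSpherical c s) (h : d =ᶠ[𝓝 s] c) :
    IsRegularSpherical d s := by
  have h' : d =ᶠ[𝓝 s] fun u => (1 : ℝ) • c u := h.trans (by simp)
  refine ⟨h.eq_of_nhds ▸ hc.1, h.deriv_eq ▸ hc.2.1, ?_⟩
  rw [curvature_of_sign_smul (one_mul 1) h']
  exact hc.2.2

variable {v w : ℝ → ℝ}

lemma principalNormal_of_sign_smul (hσ : σ * σ = 1)
    (h : unitTangent d w =ᶠ[𝓝 s] fun u => σ • unitTangent c v u) :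
    principalNormal d w =ᶠ[𝓝 s] fun u => σ • principalNormal c v u := by
  filter_upwards [eventuallyEq_deriv_of_sign_smul h] with u hu
  rw [principalNormal, principalNormal, hu, norm_sign_smul hσ, smul_comm]

/-- Both factors of the cross product carry the sign, which therefore cancels. -/
lemma binormal_of_sign_smul (hσ : σ * σ = 1)
    (h : unitTangent d w =ᶠ[𝓝 s] fun u => σ • unitTangent c v u) :
    binormal d w =ᶠ[𝓝 s] binormal c v := by
  filter_upwards [h, principalNormal_of_sign_smul hσ h] with u h1 h2
  rw [binormal, binormal, h1, h2, cross_smul_smul hσ]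

/-- Curves whose unit tangents agree up to a constant sign `σ` near `s` have principal normal,
tangent and binormal images of the same shape, up to that sign. -/
lemma indicatrices_of_sign_smul (hσ : σ * σ = 1)
    (h : unitTangent d w =ᶠ[𝓝 s] fun u => σ • unitTangent c v u) :
    geodesicCurvature (principalNormal d w) s = σ * geodesicCurvature (principalNormal c v) s ∧
      SameShape σ (principalNormal c v) (principalNormal d w) s ∧
      SameShape σ (unitTangent c v) (unitTangent d w) s ∧
      SameShape 1 (binormal c v) (binormal d w) s :=
  ⟨geodesicCurvature_of_sign_smul hσ (principalNormal_of_sign_smul hσ h),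
    sameShape_of_sign_smul hσ (principalNormal_of_sign_smul hσ h),
    sameShape_of_sign_smul hσ h,
    sameShape_one_of_eventuallyEq (binormal_of_sign_smul hσ h)⟩

end SignChange

/-! ### Regularity of spherical curves. -/

section SphericalCurves

variable {J : Set ℝ} {c n : ℝ → E3} {s : ℝ}

lemma differentiableAt_of_contDiffOn (hJ : IsOpen J) (hc : ContDiffOn ℝ ∞ c J) (hs : s ∈ J) :
    DifferentiableAt ℝ c s :=
  (hc.contDiffAt (hJ.mem_nhds hs)).differentiableAt (by simp)

/-- The product rule for two vector fields with constant inner product. -/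
lemma inner_deriv_add_eq_zero {a b : ℝ → E3} {k : ℝ} (ha : DifferentiableAt ℝ a s)
    (hb : DifferentiableAt ℝ b s) (h : ∀ᶠ u in 𝓝 s, inner ℝ (a u) (b u) = k) :
    inner ℝ (a s) (deriv b s) + inner ℝ (deriv a s) (b s) = 0 := by
  have h1 := (ha.hasDerivAt.inner ℝ hb.hasDerivAt).deriv
  have h2 : (fun u => inner ℝ (a u) (b u)) =ᶠ[𝓝 s] fun _ => k := h
  rw [← h1, h2.deriv_eq, deriv_const]

/-- A regular curve on the unit sphere has nonzero curvature. -/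
lemma isRegularSpherical_of_contDiffOn (hJ : IsOpen J) (hc : ContDiffOn ℝ ∞ c J)
    (hnorm : ∀ u ∈ J, ‖c u‖ = 1) (hs : s ∈ J) (hreg : deriv c s ≠ 0) :
    IsRegularSpherical c s := by
  have hc' : ContDiffOn ℝ ∞ (deriv c) J := hc.deriv_of_isOpen hJ (by simp)
  have hperp : ∀ u ∈ J, inner ℝ (c u) (deriv c u) = 0 := by
    intro u hu
    have hd := differentiableAt_of_contDiffOn hJ hc hu
    have h := inner_deriv_add_eq_zero (k := 1) hd hd
      (Filter.eventually_of_mem (hJ.mem_nhds hu) fun x hx => by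
        rw [real_inner_self_eq_norm_sq, hnorm x hx, one_pow])
    rw [real_inner_comm (c u) (deriv c u)] at h
    linarith
  have h2 := inner_deriv_add_eq_zero (differentiableAt_of_contDiffOn hJ hc hs)
    (differentiableAt_of_contDiffOn hJ hc' hs)
    (Filter.eventually_of_mem (hJ.mem_nhds hs) hperp)
  have hpos : 0 < inner ℝ (deriv c s) (deriv c s) := real_inner_self_pos.mpr hreg
  refine ⟨hnorm s hs, hreg, div_pos (norm_pos_iff.mpr fun h0 => ?_)
    (pow_pos (norm_pos_iff.mpr hreg) 3)⟩
  -- Since `⟨c, c'⟩ = 0` and `⟨c, c''⟩ = -‖c'‖²`, Binet–Cauchy gives `⟨c' × c'', c × c'⟩ = ‖c'‖⁴ >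
  -- 0`, so `c' × c''` cannot vanish.
  have h3 := inner_cross_cross (deriv c s) (deriv (deriv c) s) (c s) (deriv c s)
  rw [h0, inner_zero_left, real_inner_comm, hperp s hs, real_inner_comm (c s)] at h3
  nlinarith [mul_pos hpos hpos]

/-- The normalized velocity of a regular curve on the unit sphere is again regular. -/
lemma isRegularSpherical_normalized_deriv (hJ : IsOpen J) (hn : ContDiffOn ℝ ∞ n J)
    (hnorm : ∀ u ∈ J, ‖n u‖ = 1) (hreg : ∀ u ∈ J, deriv n u ≠ 0) (hs : s ∈ J) :
    IsRegularSpherical (fun u => ‖deriv n u‖⁻¹ • deriv n u) s := by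
  have hn' : ContDiffOn ℝ ∞ (deriv n) J := hn.deriv_of_isOpen hJ (by simp)
  have hc : ContDiffOn ℝ ∞ (fun u => ‖deriv n u‖⁻¹ • deriv n u) J :=
    ((hn'.norm ℝ hreg).inv fun u hu => norm_ne_zero_iff.mpr (hreg u hu)).smul hn'
  refine isRegularSpherical_of_contDiffOn hJ hc (fun u hu => ?_) hs fun h0 => ?_
  · rw [norm_smul, norm_inv, norm_norm, inv_mul_cancel₀ (norm_ne_zero_iff.mpr (hreg u hu))]
  · have hperp : ∀ u ∈ J, inner ℝ (n u) (‖deriv n u‖⁻¹ • deriv n u) = 0 := by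
      intro u hu
      have hd := differentiableAt_of_contDiffOn hJ hn hu
      have h := inner_deriv_add_eq_zero (k := 1) hd hd
        (Filter.eventually_of_mem (hJ.mem_nhds hu) fun x hx => by
          rw [real_inner_self_eq_norm_sq, hnorm x hx, one_pow])
      rw [real_inner_comm (n u) (deriv n u)] at h
      rw [inner_smul_right, show inner ℝ (n u) (deriv n u) = 0 by linarith, mul_zero]
    -- With `t = n' / ‖n'‖`, differentiating `⟨n, t⟩ = 0` gives `⟨n, t'⟩ = -‖n'‖`, so `t' = 0` would
    -- force `n' = 0`.
    have h := inner_deriv_add_eq_zero (differentiableAt_of_contDiffOn hJ hn hs)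
      (differentiableAt_of_contDiffOn hJ hc hs)
      (Filter.eventually_of_mem (hJ.mem_nhds hs) hperp)
    rw [h0, inner_zero_right, inner_smul_right, zero_add, mul_eq_zero, inv_eq_zero,
      norm_eq_zero, inner_self_eq_zero, or_self] at h
    exact hreg s hs h

end SphericalCurves

/-! ### Frenet frames in the group and their indicatrices. -/

section FrenetCurves

/-- A vector is determined by its coordinates in an orthonormal frame. -/
lemma eq_of_inner_orthonormal {a b c x y : E3} (h : Orthonormal ℝ ![a, b, c])
    (ha : inner ℝ a x = inner ℝ a y) (hb : inner ℝ b x = inner ℝ b y)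
    (hc : inner ℝ c x = inner ℝ c y) : x = y := by
  let e := basisOfOrthonormalOfCardEqFinrank h (by simp)
  refine InnerProductSpace.ext_inner_left_basis e fun i => ?_
  simp only [e, coe_basisOfOrthonormalOfCardEqFinrank]
  fin_cases i
  · exact ha
  · exact hb
  · exact hc

variable {E : Type*} [NormedAddCommGroup E] [NormedSpace ℝ E]
  {G : Type*} [TopologicalSpace G] [ChartedSpace E G] [Group G]
  {X : Module.Basis (Fin 3) ℝ (GroupLieAlgebra 𝓘(ℝ, E) G)}
  {J : Set ℝ} {α : ℝ → G} {A : Apparatus} {s : ℝ}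

lemma bracket_self (a : E3) : bracket X a a = 0 := by
  have h : ⁅toAlg X a, toAlg X a⁆ = 0 := by
    simp [GroupLieAlgebra.bracket_def]
  simp only [bracket, h]
  ext i
  simp

namespace IsFrenetCurve

lemma mem_nhds (h : IsFrenetCurve X J α A) (hs : s ∈ J) : J ∈ 𝓝 s := h.isOpen.mem_nhds hs

lemma deriv_T (h : IsFrenetCurve X J α A) (hs : s ∈ J) : deriv A.T s = A.κ s • A.N s := by
  have := h.frenet_T s hs
  rwa [covDeriv, bracket_self, smul_zero, add_zero] at this

lemma inner_frame (h : IsFrenetCurve X J α A) (hs : s ∈ J) :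
    inner ℝ (A.T s) (A.T s) = 1 ∧ inner ℝ (A.N s) (A.N s) = 1 ∧ inner ℝ (A.B s) (A.B s) = 1 ∧
      inner ℝ (A.T s) (A.N s) = 0 ∧ inner ℝ (A.T s) (A.B s) = 0 ∧
      inner ℝ (A.N s) (A.B s) = 0 := by
  have ho := orthonormal_iff_ite.mp (h.orthonormal s hs)
  exact ⟨by simpa using ho 0 0, by simpa using ho 1 1, by simpa using ho 2 2,
    by simpa using ho 0 1, by simpa using ho 0 2, by simpa using ho 1 2⟩

lemma norm_N (h : IsFrenetCurve X J α A) (hs : s ∈ J) : ‖A.N s‖ = 1 := by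
  simpa using (h.orthonormal s hs).1 1

/-- Pair the Frenet equation for `N` with `B`: the bracket term contributes exactly `τ_G`. -/
lemma inner_deriv_N_B (h : IsFrenetCurve X J α A) (hs : s ∈ J) :
    inner ℝ (deriv A.N s) (A.B s) = A.τ s - tauG X A s := by
  obtain ⟨-, -, hB, -, hTB, -⟩ := h.inner_frame hs
  have hN := congrArg (inner ℝ · (A.B s)) (h.frenet_N s hs)
  simp only [covDeriv, inner_add_left, real_inner_smul_left, hB, hTB] at hN
  rw [tauG]
  linarith

/-- Differentiating the orthonormality relations gives the coordinates of `B'` in the frame from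
`T'` and `⟨N', B⟩`, so `[T, B]` need not be computed. -/
lemma deriv_B (h : IsFrenetCurve X J α A) (hs : s ∈ J) :
    deriv A.B s = -(A.τ s - tauG X A s) • A.N s := by
  have dT := differentiableAt_of_contDiffOn h.isOpen h.smooth_T hs
  have dN := differentiableAt_of_contDiffOn h.isOpen h.smooth_N hs
  have dB := differentiableAt_of_contDiffOn h.isOpen h.smooth_B hs
  obtain ⟨hT, hN, hB, hTN, hTB, hNB⟩ := h.inner_frame hs
  have e1 := inner_deriv_add_eq_zero dT dB
    (Filter.eventually_of_mem (h.mem_nhds hs) fun u hu => (h.inner_frame hu).2.2.2.2.1)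
  have e2 := inner_deriv_add_eq_zero dN dB
    (Filter.eventually_of_mem (h.mem_nhds hs) fun u hu => (h.inner_frame hu).2.2.2.2.2)
  have e3 := inner_deriv_add_eq_zero dB dB
    (Filter.eventually_of_mem (h.mem_nhds hs) fun u hu => (h.inner_frame hu).2.2.1)
  rw [h.deriv_T hs, real_inner_smul_left, hNB] at e1
  rw [h.inner_deriv_N_B hs] at e2
  rw [real_inner_comm (A.B s) (deriv A.B s)] at e3
  refine eq_of_inner_orthonormal (h.orthonormal s hs) ?_ ?_ ?_
  · rw [inner_smul_right, hTN]; linarith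
  · rw [inner_smul_right, hN]; linarith
  · rw [inner_smul_right, real_inner_comm (A.N s) (A.B s), hNB]; linarith

/-- Differentiating `⟨T, N⟩ = 0` gives `⟨T, N'⟩ = -κ`, which is nonzero. -/
lemma deriv_N_ne_zero (h : IsFrenetCurve X J α A) (hs : s ∈ J) : deriv A.N s ≠ 0 := by
  intro h0
  have e := inner_deriv_add_eq_zero (differentiableAt_of_contDiffOn h.isOpen h.smooth_T hs)
    (differentiableAt_of_contDiffOn h.isOpen h.smooth_N hs)
    (Filter.eventually_of_mem (h.mem_nhds hs) fun u hu => (h.inner_frame hu).2.2.2.1)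
  rw [h0, inner_zero_right, h.deriv_T hs, real_inner_smul_left, (h.inner_frame hs).2.1] at e
  linarith [h.curvature_pos s hs]

lemma norm_deriv_T (h : IsFrenetCurve X J α A) (hs : s ∈ J) : ‖deriv A.T s‖ = A.κ s := by
  rw [h.deriv_T hs, norm_smul, h.norm_N hs, mul_one, Real.norm_eq_abs,
    abs_of_pos (h.curvature_pos s hs)]

lemma norm_deriv_B (h : IsFrenetCurve X J α A) (hs : s ∈ J) :
    ‖deriv A.B s‖ = |A.τ s - tauG X A s| := by
  rw [h.deriv_B hs, norm_smul, h.norm_N hs, mul_one, Real.norm_eq_abs, abs_neg]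

lemma unitTangent_T (h : IsFrenetCurve X J α A) (hs : s ∈ J) :
    unitTangent A.T (tangentRate A) s = A.N s := by
  rw [unitTangent, tangentRate, h.deriv_T hs, smul_smul,
    inv_mul_cancel₀ (h.curvature_pos s hs).ne', one_smul]

lemma unitTangent_T_norm (h : IsFrenetCurve X J α A) (hs : s ∈ J) :
    unitTangent A.T (fun u => ‖deriv A.T u‖) s = A.N s := by
  rw [← h.unitTangent_T hs, unitTangent, unitTangent, h.norm_deriv_T hs, tangentRate]

lemma unitTangent_B (h : IsFrenetCurve X J α A) (hs : s ∈ J) (hτ : A.τ s - tauG X A s ≠ 0) :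
    unitTangent A.B (binormalRate X A) s = A.N s := by
  rw [unitTangent, binormalRate, h.deriv_B hs, smul_smul, inv_mul_cancel₀ (neg_ne_zero.mpr hτ),
    one_smul]

lemma unitTangent_B_norm (h : IsFrenetCurve X J α A) (hs : s ∈ J) (hτ : A.τ s - tauG X A s ≠ 0) :
    unitTangent A.B (fun u => ‖deriv A.B u‖) s =
      -Real.sign (A.τ s - tauG X A s) • A.N s := by
  rw [unitTangent, h.norm_deriv_B hs, h.deriv_B hs, smul_smul]
  congr 1
  rcases hτ.lt_or_gt with hlt | hgt
  · rw [abs_of_neg hlt, Real.sign_of_neg hlt, inv_mul_cancel₀ (by linarith), neg_neg]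
  · rw [abs_of_pos hgt, Real.sign_of_pos hgt, mul_neg, inv_mul_cancel₀ hτ]

/-- Continuity of `τ` is not part of the Frenet data; it is `τ - τ_G = ⟨N', B⟩` that is seen to be
continuous. -/
lemma eventually_sign_eq (h : IsFrenetCurve X J α A) (hs : s ∈ J)
    (hτ : A.τ s - tauG X A s ≠ 0) :
    ∀ᶠ u in 𝓝 s, Real.sign (A.τ u - tauG X A u) = Real.sign (A.τ s - tauG X A s) := by
  have hN' : ContDiffOn ℝ ∞ (deriv A.N) J := h.smooth_N.deriv_of_isOpen h.isOpen (by simp)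
  have hcont : ContinuousAt (fun u => A.τ u - tauG X A u) s := by
    refine ((differentiableAt_of_contDiffOn h.isOpen hN' hs).continuousAt.inner
      (differentiableAt_of_contDiffOn h.isOpen h.smooth_B hs).continuousAt).congr ?_
    exact Filter.eventually_of_mem (h.mem_nhds hs) fun u hu => h.inner_deriv_N_B hu
  rcases hτ.lt_or_gt with hlt | hgt
  · filter_upwards [hcont.eventually_lt_const hlt] with u hu
    rw [Real.sign_of_neg hu, Real.sign_of_neg hlt]
  · filter_upwards [hcont.eventually_const_lt hgt] with u hu
    rw [Real.sign_of_pos hu, Real.sign_of_pos hgt]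

lemma isRegularSpherical_principalNormal (h : IsFrenetCurve X J α A) {c : ℝ → E3} {v : ℝ → ℝ}
    (hc : ∀ u ∈ J, unitTangent c v u = A.N u) (hs : s ∈ J) :
    IsRegularSpherical (principalNormal c v) s := by
  refine (isRegularSpherical_normalized_deriv h.isOpen h.smooth_N (fun u hu => h.norm_N hu)
    (fun u hu => h.deriv_N_ne_zero hu) hs).congr ?_
  have he : unitTangent c v =ᶠ[𝓝 s] A.N := Filter.eventually_of_mem (h.mem_nhds hs) hc
  filter_upwards [he.deriv] with u hu
  rw [principalNormal, hu]

end IsFrenetCurve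

end FrenetCurves

end LieBertrand

theorem corollary3p12
    {E : Type*} [NormedAddCommGroup E] [NormedSpace ℝ E]
    {G : Type*} [TopologicalSpace G] [ChartedSpace E G] [Group G]
    [LieGroup 𝓘(ℝ, E) ∞ G]
    (g : Bundle.ContMDiffRiemannianMetric 𝓘(ℝ, E) ∞ E (fun x : G => TangentSpace 𝓘(ℝ, E) x))
    (hg : IsBiInvariant g)
    (X : Module.Basis (Fin 3) ℝ (GroupLieAlgebra 𝓘(ℝ, E) G))
    (hX : IsOrthonormalBasis g X)
    (J : Set ℝ) (α : ℝ → G) (A : Apparatus)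
    (hα : IsBertrandCurve X J α A)
    (hτ : ∀ s ∈ J, A.τ s - tauG X A s ≠ 0) :
    -- natural parameters with `d s_t / d s = κ` and `d s_b / d s = -(τ - τ_G)`
    (∀ s ∈ J,
      |tangentRate A s| = ‖deriv A.T s‖ ∧ |binormalRate X A s| = ‖deriv A.B s‖ ∧
      IsRegularSpherical (principalNormal A.T (tangentRate A)) s ∧
      IsRegularSpherical (principalNormal A.B (binormalRate X A)) s ∧
      geodesicCurvature (principalNormal A.T (tangentRate A)) s =
        geodesicCurvature (principalNormal A.B (binormalRate X A)) s ∧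
      SameShape 1 (principalNormal A.T (tangentRate A))
        (principalNormal A.B (binormalRate X A)) s ∧
      SameShape 1 (unitTangent A.T (tangentRate A)) (unitTangent A.B (binormalRate X A)) s ∧
      SameShape 1 (binormal A.T (tangentRate A)) (binormal A.B (binormalRate X A)) s) ∧
    -- increasing natural parameters, for which both indicatrices have positive curvature
    (∀ s ∈ J,
      geodesicCurvature (principalNormal A.B (fun u => ‖deriv A.B u‖)) s =
        -Real.sign (A.τ s - tauG X A s) *
          geodesicCurvature (principalNormal A.T (fun u => ‖deriv A.T u‖)) s ∧
      SameShape (-Real.sign (A.τ s - tauG X A s))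
        (principalNormal A.T (fun u => ‖deriv A.T u‖))
        (principalNormal A.B (fun u => ‖deriv A.B u‖)) s ∧
      SameShape (-Real.sign (A.τ s - tauG X A s))
        (unitTangent A.T (fun u => ‖deriv A.T u‖))
        (unitTangent A.B (fun u => ‖deriv A.B u‖)) s ∧
      SameShape 1
        (binormal A.T (fun u => ‖deriv A.T u‖))
        (binormal A.B (fun u => ‖deriv A.B u‖)) s) := by
  obtain ⟨-, -, -, h, -⟩ := hα
  refine ⟨fun s hs => ?_, fun s hs => ?_⟩
  · have hT : ∀ u ∈ J, unitTangent A.T (tangentRate A) u = A.N u := fun u hu => h.unitTangent_T hu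
    have hB : ∀ u ∈ J, unitTangent A.B (binormalRate X A) u = A.N u :=
      fun u hu => h.unitTangent_B hu (hτ u hu)
    obtain ⟨hΓ, hshape⟩ := indicatrices_of_sign_smul (one_mul (1 : ℝ))
      (c := A.T) (v := tangentRate A) (d := A.B) (w := binormalRate X A)
      (Filter.eventually_of_mem (h.mem_nhds hs) fun u hu => by
        simp only [hT u hu, hB u hu, one_smul])
    refine ⟨?_, ?_, h.isRegularSpherical_principalNormal hT hs,
      h.isRegularSpherical_principalNormal hB hs, by rw [hΓ, one_mul], hshape⟩
    · rw [tangentRate, h.norm_deriv_T hs, abs_of_pos (h.curvature_pos s hs)]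
    · rw [binormalRate, h.norm_deriv_B hs, abs_neg]
  · refine indicatrices_of_sign_smul ?_ ?_
    · rcases Real.sign_apply_eq_of_ne_zero _ (hτ s hs) with h1 | h1 <;> rw [h1] <;> norm_num
    -- The sign is frozen at its value at `s`: the invariants involve derivatives, so a constant
    -- factor near `s` is required.
    · filter_upwards [h.mem_nhds hs, h.eventually_sign_eq hs (hτ s hs)] with u hu hsign
      rw [h.unitTangent_B_norm hu (hτ u hu), h.unitTangent_T_norm hu, hsign]
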